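/- For $n\ge 1$ let $p(\lambda)$, $\lambda\vdash n$, be the distribution of a random partition $\pi_n$ of $n$, and suppose that $p$ is a \emph{partition structure}: for all $1\le m\le n$, if $m$ of $n$ balls that are grouped in boxes according to $\pi_n$ are sampled uniformly at random without replacement, then the induced random partition of $m$ has the distribution of $\pi_m$. A \emph{deletion kernel} $d$ assigns to every partition $\lambda$ of every $n\ge1$ a probability distribution $d(\lambda,\cdot)$ on the set of part sizes of $\lambda$. Put $$q(n,x)=\sum_{\lambda\vdash n,\ x\in\lambda} d(\lambda,x)\,p(\lambda)\qquad(1\le x\le n).$$ Suppose that $p$ is \emph{regenerative} with respect to $d$, that is, if $X_n$ is a part of $\pi_n$ chosen with $\mathbb P(X_n=x\mid\pi_n=\lambda)=d(\lambda,x)$, then for all $1\le x<n$, conditionally given $X_n=x$, the remaining partition of $n-x$ has the distribution of $\pi_{n-x}$; equivalently, $$p(\lambda)\,d(\lambda,x)=q(n,x)\,p(\lambda-\{x\})\qquad(\lambda\vdash n,\ x\in\lambda,\ x<n),$$ where $\lambda-\{x\}$ is $\lambda$ with one part $x$ deleted. Then (i) either $p$ is a \emph{hook} partition structure, i.e. for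 every $n\ge1$, with probability one, $\pi_n$ has at most one part larger than $1$; (ii) or $p$, $d$ and $q$ are strictly positive at all admissible arguments, i.e. for all $n\ge1$: $p(\lambda)>0$ for all $\lambda\vdash n$, $d(\lambda,x)>0$ for all $\lambda\vdash n$ and all $x\in\lambda$, and $q(n,x)>0$ for all $1\le x\le n$. Moreover, (i) holds if and only if $p(2,2)=0$, and (ii) holds if and only if $p(2,2)>0$, where $p(2,2)=\mathbb P(\pi_4=(2,2))$. -/

import Mathlib

namespace RegenPartition

/-- A probability is assigned to every partition `l` of every `n`; the value at `n = 0` is never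
used. `p n l` stands for `ℙ (π_n = l)`. -/
abbrev PartFun : Type := (n : ℕ) → n.Partition → ℝ

/-- `d n l x` stands for `ℙ (X_n = x | π_n = l)`, where `l` is a partition of `n`. -/
abbrev Kernel : Type := (n : ℕ) → n.Partition → ℕ → ℝ

/-- The `n` balls of a partition of `n`: one box for each part (parts counted with multiplicity),
and `x` balls in a box that corresponds to a part of size `x`. -/
abbrev Balls {n : ℕ} (l : n.Partition) : Type := (b : l.parts.ToType) × Fin b.1

instance (s : Multiset ℕ) : DecidableEq s.ToType :=
  inferInstanceAs (DecidableEq ((x : ℕ) × Fin (s.count x)))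

theorem card_balls {n : ℕ} (l : n.Partition) : Fintype.card (Balls l) = n := by
  rw [Fintype.card_sigma]
  simp only [Fintype.card_fin]
  rw [← Multiset.sum_eq_sum_coe]
  exact l.parts_sum

/-- The multiset of positive box contents when only the balls in `S` are kept. -/
def sampleParts {n : ℕ} (l : n.Partition) (S : Finset (Balls l)) : Multiset ℕ :=
  ((Finset.univ : Finset l.parts.ToType).val.map
    (fun b => (S.filter (fun a => a.1 = b)).card)).filter (fun k => k ≠ 0)

/-- The number of samples of `m` of the `n` balls of `l` that induce the partition `u` of `m`. -/
def sampleCount {n m : ℕ} (l : n.Partition) (u : m.Partition) : ℕ :=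
  ((Finset.powersetCard m (Finset.univ : Finset (Balls l))).filter
    (fun S => sampleParts l S = u.parts)).card

/-- The probability that `m` balls, drawn uniformly at random without replacement from the `n`
balls of `l`, induce the partition `u` of `m`. -/
noncomputable def sampleProb {n m : ℕ} (l : n.Partition) (u : m.Partition) : ℝ :=
  (sampleCount l u : ℝ) / (n.choose m : ℝ)

/-- A partition structure: a probability distribution on the partitions of `n` for each `n ≥ 1`,
such that for `1 ≤ m ≤ n` the distribution for `m` is derived from that for `n` by random
sampling. -/
structure IsPartitionStructure (p : PartFun) : Prop where
  nonneg : ∀ n : ℕ, 1 ≤ n → ∀ l : n.Partition, 0 ≤ p n l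
  sum_one : ∀ n : ℕ, 1 ≤ n → ∑ l : n.Partition, p n l = 1
  consistent : ∀ m n : ℕ, 1 ≤ m → m ≤ n → ∀ u : m.Partition,
    p m u = ∑ l : n.Partition, p n l * sampleProb l u

/-- A deletion kernel: for each partition `l` of `n ≥ 1`, a probability distribution on the set of
part sizes of `l`. -/
structure IsDeletionKernel (d : Kernel) : Prop where
  nonneg : ∀ n : ℕ, 1 ≤ n → ∀ (l : n.Partition) (x : ℕ), 0 ≤ d n l x
  eq_zero : ∀ n : ℕ, 1 ≤ n → ∀ (l : n.Partition) (x : ℕ), x ∉ l.parts → d n l x = 0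
  sum_one : ∀ n : ℕ, 1 ≤ n → ∀ l : n.Partition, ∑ x ∈ l.parts.toFinset, d n l x = 1

/-- `q(n, x) = ℙ (X_n = x)`, the distribution of the deleted part. -/
noncomputable def deletedPartProb (p : PartFun) (d : Kernel) (n x : ℕ) : ℝ :=
  ∑ l : n.Partition with x ∈ l.parts, d n l x * p n l

/-- The partition `l - {x}` of `n - x` obtained by deleting (one copy of) the part `x`. -/
def removePart {n : ℕ} (l : n.Partition) (x : ℕ) (hx : x ∈ l.parts) : (n - x).Partition where
  parts := l.parts.erase x
  parts_pos := fun hi => l.parts_pos (Multiset.mem_of_mem_erase hi)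
  parts_sum := by
    have h := Multiset.sum_erase hx
    rw [l.parts_sum] at h
    omega

/-- For each `n ≥ 1`, the random partition of `n` is regenerative with respect to deletion of a
part chosen according to `d`: for `1 ≤ x < n`, given that `X_n = x`, the remaining partition
of `n - x` has distribution `p (n - x)`, that is
`ℙ (π_n = l, X_n = x) = ℙ (X_n = x) * ℙ (π_{n-x} = l - {x})` whenever `x` is a part of `l`. -/
def IsRegenerativeWrt (p : PartFun) (d : Kernel) : Prop :=
  ∀ n : ℕ, 1 ≤ n → ∀ (l : n.Partition) (x : ℕ) (hx : x ∈ l.parts), x < n →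
    p n l * d n l x = deletedPartProb p d n x * p (n - x) (removePart l x hx)

/-- A hook: at most one part is larger than `1`. -/
def IsHook {n : ℕ} (l : n.Partition) : Prop :=
  (l.parts.filter (fun x => 1 < x)).card ≤ 1

open Classical in
/-- `π_n` is a hook with probability one, for every `n ≥ 1`. -/
def IsHookStructure (p : PartFun) : Prop :=
  ∀ n : ℕ, 1 ≤ n → ∑ l : n.Partition with IsHook l, p n l = 1

/-- `p`, `d` and `q` are strictly positive at all admissible arguments: `p(l)` for every partition
`l` of every `n ≥ 1`, `d(l, x)` for every part `x` of `l`, and `q(n, x)` for `1 ≤ x ≤ n`. -/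
structure AllPositive (p : PartFun) (d : Kernel) : Prop where
  p_pos : ∀ n : ℕ, 1 ≤ n → ∀ l : n.Partition, 0 < p n l
  d_pos : ∀ n : ℕ, 1 ≤ n → ∀ (l : n.Partition) (x : ℕ), x ∈ l.parts → 0 < d n l x
  q_pos : ∀ n : ℕ, 1 ≤ n → ∀ x : ℕ, 1 ≤ x → x ≤ n → 0 < deletedPartProb p d n x

/-- The partition `(2, 2)` of `4`. -/
def twoTwo : Nat.Partition 4 where
  parts := {2, 2}
  parts_pos := by
    intro i hi
    simp at hi
    omega
  parts_sum := by simp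

end RegenPartition

/-! Sampling passes positivity down: if a partition has positive probability, so does any nonempty
one obtained from it by removing balls. A non-hook of positive probability therefore gives `p(2,2) >
0`, which settles the hook case without regeneration.

Let `p(2,2) > 0`. If `p(k,k)` vanished for some `k`, almost surely at most one part would be `≥ k`.
A sample inducing `(2,2)` would then have two balls in a common box of size `< k`, so at most `k
n^3` samples qualify out of about `n^4/24`; letting `n → ∞` forces `p(2,2) = 0`. So all `p(k,k) > 0`
(`onParts_pair_pos_of_twoTwo`).

From a partition with all parts `x` only `x` can be deleted, so `p(x^r) > 0` implies `q(rx,x) > 0`.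
In particular `q(2m,m) > 0`, and regeneration lets a part `m` be added to any partition of `m` of
positive probability. With `m = rk` and sampling down, `p(k^r) > 0` gives `p(k^(r+1)) > 0`; every
partition lies below some `K^r`, so `p > 0` (`onParts_pos`).

Comparing regeneration at levels `n` and `n+1` gives, for `1 ≤ x < n`, `(x+1) q(n+1,x+1) + (n+1-x)
q(n+1,x) = (n+1-q(n+1,1)) q(n,x)`. For `2 ≤ x < n` a zero `q(n,x)` would thus persist for all larger
`n`, against `q(nx,x) > 0`. Positivity of `d` follows from regeneration. -/

namespace RegenPartition

/-! ### Sampling all balls but one -/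

/-- The multiset of part sizes after one ball is removed from a part of size `y`. -/
def dropBall (s : Multiset ℕ) (y : ℕ) : Multiset ℕ :=
  s.erase y + if y = 1 then 0 else {y - 1}

/-- The number of balls whose removal from the parts `s` leaves the parts `u`. -/
def dropCount (s u : Multiset ℕ) : ℕ :=
  (s.map fun y => if dropBall s y = u then y else 0).sum

/-- The function `p` on multisets of positive integers, with value `1` at the empty multiset. -/
noncomputable def onParts (p : PartFun) (s : Multiset ℕ) : ℝ :=
  open Classical in
  if s = 0 then 1 else
    if h : ∀ i ∈ s, 0 < i then p s.sum ⟨s, fun hi => h _ hi, rfl⟩ else 0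

theorem onParts_zero (p : PartFun) : onParts p 0 = 1 := by simp [onParts]

theorem onParts_parts (p : PartFun) {n : ℕ} (hn : 1 ≤ n) (l : n.Partition) :
    onParts p l.parts = p n l := by
  obtain ⟨s, pos, rfl⟩ := l
  have h0 : s ≠ 0 := by rintro rfl; simp at hn
  have h1 : ∀ i ∈ s, 0 < i := fun i hi => pos hi
  rw [onParts, if_neg h0, dif_pos h1]

/-- The removed ball lies either in the distinguished part `x` or in another one; in the second case
`x` survives, hence occurs in `u` and can be cancelled. -/
theorem dropCount_cons (x : ℕ) (s u : Multiset ℕ) :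
    dropCount (x ::ₘ s) u =
      (if (s + if x = 1 then 0 else {x - 1}) = u then x else 0) +
        if x ∈ u then dropCount s (u.erase x) else 0 := by
  have h : ∀ y ∈ s, (if dropBall (x ::ₘ s) y = u then y else 0) =
      if x ∈ u then (if dropBall s y = u.erase x then y else 0) else 0 := by
    intro y hy
    have e : dropBall (x ::ₘ s) y = x ::ₘ dropBall s y := by
      simp [dropBall, Multiset.erase_cons_tail_of_mem hy]
    rw [e]
    by_cases hx : x ∈ u
    · rw [if_pos hx]
      congr 1
      rw [eq_iff_iff]
      constructor
      · rintro rfl; simp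
      · intro h; rw [h, Multiset.cons_erase hx]
    · rw [if_neg hx, if_neg]
      rintro rfl
      exact hx (Multiset.mem_cons_self _ _)
  unfold dropCount
  rw [Multiset.map_cons, Multiset.sum_cons, Multiset.map_congr rfl h]
  congr 1
  · simp [dropBall]
  · split_ifs <;> simp

theorem map_size_univ (s : Multiset ℕ) :
    (Finset.univ : Finset s.ToType).val.map (fun b => b.1) = s :=
  Multiset.map_univ_coe s

theorem sampleParts_erase {n : ℕ} (l : n.Partition) (a : Balls l) :
    sampleParts l (Finset.univ.erase a) = dropBall l.parts a.1.1 := by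
  classical
  have hcard : ∀ b : l.parts.ToType,
      (((Finset.univ : Finset (Balls l)).erase a).filter (fun c => c.1 = b)).card =
        if b = a.1 then b.1 - 1 else b.1 := by
    intro b
    have h1 : ((Finset.univ : Finset (Balls l)).filter (fun c => c.1 = b)).card = b.1 := by
      have : (Finset.univ : Finset (Balls l)).filter (fun c => c.1 = b) =
          (Finset.univ : Finset (Fin b.1)).map (Function.Embedding.sigmaMk b) := by
        ext ⟨c, i⟩
        simp only [Finset.mem_filter, Finset.mem_univ, true_and, Finset.mem_map,
          Function.Embedding.sigmaMk_apply]
        constructor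
        · rintro rfl; exact ⟨i, rfl⟩
        · rintro ⟨j, hj⟩; exact (congrArg Sigma.fst hj).symm
      rw [this, Finset.card_map, Finset.card_univ, Fintype.card_fin]
    rw [Finset.filter_erase]
    split_ifs with hb
    · rw [Finset.card_erase_of_mem (by simp [hb]), h1]
    · rw [Finset.erase_eq_of_notMem (by simp [Ne.symm hb]), h1]
  unfold sampleParts
  simp only [hcard]
  have hmem : a.1 ∈ (Finset.univ : Finset l.parts.ToType).val := Finset.mem_univ _
  have hsize : ((Finset.univ : Finset l.parts.ToType).val.erase a.1).map (fun b => b.1) =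
      l.parts.erase a.1.1 := by
    have h := map_size_univ l.parts
    rw [← Multiset.cons_erase hmem, Multiset.map_cons] at h
    exact (Multiset.erase_cons_head _ _).symm.trans (congrArg (fun t => t.erase a.1.1) h)
  have hpos : 0 < a.1.1 := l.parts_pos (Multiset.coe_mem)
  rw [← Multiset.cons_erase hmem, Multiset.map_cons]
  have hrest : ((Finset.univ : Finset l.parts.ToType).val.erase a.1).map
      (fun b => if b = a.1 then b.1 - 1 else b.1) = l.parts.erase a.1.1 := by
    rw [← hsize]
    refine Multiset.map_congr rfl fun b hb => ?_
    rw [if_neg]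
    rintro rfl
    exact (Finset.univ : Finset l.parts.ToType).nodup.notMem_erase hb
  rw [hrest, if_pos rfl, Multiset.filter_cons, Multiset.filter_eq_self.2, add_comm]
  · unfold dropBall
    congr 1
    by_cases h1 : a.1.1 = 1
    · simp [h1]
    · rw [if_neg h1, if_pos (by omega)]
  · intro i hi
    exact (l.parts_pos (Multiset.mem_of_mem_erase hi)).ne'

/-- A sample of all balls but one is the complement of a single ball, and a part `y` contributes `y`
choices of that ball. -/
theorem sampleCount_succ {n : ℕ} (l : (n + 1).Partition) (u : n.Partition) :
    sampleCount l u = dropCount l.parts u.parts := by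
  classical
  have hset : (Finset.powersetCard n (Finset.univ : Finset (Balls l))).filter
      (fun S => sampleParts l S = u.parts) =
      ((Finset.univ : Finset (Balls l)).filter
        (fun a => dropBall l.parts a.1.1 = u.parts)).image (fun a => Finset.univ.erase a) := by
    ext S
    simp only [Finset.mem_filter, Finset.mem_powersetCard, Finset.mem_image, Finset.mem_univ,
      true_and, Finset.subset_univ]
    constructor
    · rintro ⟨hS, hu⟩
      have hc : Sᶜ.card = 1 := by
        rw [Finset.card_compl, card_balls, hS]; omega
      obtain ⟨a, ha⟩ := Finset.card_eq_one.1 hc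
      have hSa : S = Finset.univ.erase a := by
        rw [← compl_compl S, ha]; ext; simp
      subst hSa
      exact ⟨a, by rw [← sampleParts_erase, hu], rfl⟩
    · rintro ⟨a, ha, rfl⟩
      refine ⟨?_, by rw [sampleParts_erase, ha]⟩
      rw [Finset.card_erase_of_mem (Finset.mem_univ _), Finset.card_univ, card_balls]; rfl
  unfold sampleCount
  rw [hset, Finset.card_image_of_injective]
  · rw [Finset.card_filter, Fintype.sum_sigma]
    have hb : ∀ b : l.parts.ToType,
        (∑ _i : Fin b.1, if dropBall l.parts b.1 = u.parts then 1 else 0) =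
          if dropBall l.parts b.1 = u.parts then b.1 else 0 := by
      intro b
      rw [Finset.sum_const, Finset.card_univ, Fintype.card_fin, smul_eq_mul, mul_ite, mul_one,
        mul_zero]
    refine (Finset.sum_congr rfl fun b _ => hb b).trans ?_
    have h := congrArg (Multiset.map fun y => if dropBall l.parts y = u.parts then y else 0)
      (map_size_univ l.parts)
    rw [Multiset.map_map] at h
    exact congrArg Multiset.sum h
  · intro a b hab
    by_contra hne
    have : a ∈ Finset.univ.erase b := by simp [hne]
    simp only at hab
    rw [← hab] at this
    simp at this

/-! ### Positivity descends under sampling -/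

theorem onParts_nonneg {p : PartFun} (hp : IsPartitionStructure p) (s : Multiset ℕ) :
    0 ≤ onParts p s := by
  unfold onParts
  split_ifs with h0 h
  · exact zero_le_one
  · refine hp.nonneg _ ?_ _
    obtain ⟨a, ha⟩ := Multiset.exists_mem_of_ne_zero h0
    exact (h a ha).trans_le (Multiset.le_sum_of_mem ha)
  · exact le_rfl

theorem parts_pos_of_onParts_pos {p : PartFun} {s : Multiset ℕ} (h : 0 < onParts p s) :
    ∀ i ∈ s, 0 < i := by
  by_contra hs
  have h0 : s ≠ 0 := by rintro rfl; simp at hs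
  simp [onParts, h0, hs] at h

theorem onParts_consistent {p : PartFun} (hp : IsPartitionStructure p) {n : ℕ} (hn : 1 ≤ n)
    (u : n.Partition) :
    ((n : ℝ) + 1) * onParts p u.parts =
      ∑ l : (n + 1).Partition, onParts p l.parts * dropCount l.parts u.parts := by
  rw [onParts_parts p hn, hp.consistent n (n + 1) hn (Nat.le_succ n) u, Finset.mul_sum]
  refine Finset.sum_congr rfl fun l _ => ?_
  rw [onParts_parts p (by omega), sampleProb, sampleCount_succ, Nat.choose_succ_self_right]
  push_cast
  have : (n : ℝ) + 1 ≠ 0 := by positivity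
  field_simp

/-- The consistency sum for the smaller partition has nonnegative terms, and the term of `y ::ₘ t`
is positive. -/
theorem onParts_pos_dropBall {p : PartFun} (hp : IsPartitionStructure p) {t : Multiset ℕ} {y : ℕ}
    (h : 0 < onParts p (y ::ₘ t)) (h0 : (t + if y = 1 then 0 else {y - 1}) ≠ 0) :
    0 < onParts p (t + if y = 1 then 0 else {y - 1}) := by
  have hpos := parts_pos_of_onParts_pos h
  have hy : 0 < y := hpos y (Multiset.mem_cons_self _ _)
  set u := t + if y = 1 then 0 else {y - 1} with hu
  have hupos : ∀ i ∈ u, 0 < i := by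
    intro i hi
    rcases Multiset.mem_add.1 hi with hi | hi
    · exact hpos i (Multiset.mem_cons_of_mem hi)
    · split_ifs at hi
      · simp at hi
      · rw [Multiset.mem_singleton] at hi; omega
  have hsum : (y ::ₘ t).sum = u.sum + 1 := by
    rw [hu, Multiset.sum_cons, Multiset.sum_add]
    split_ifs with h1
    · simp [h1, add_comm]
    · simp; omega
  have hu1 : 1 ≤ u.sum := by
    obtain ⟨a, ha⟩ := Multiset.exists_mem_of_ne_zero h0
    exact (hupos a ha).trans_le (Multiset.le_sum_of_mem ha)
  have hc := onParts_consistent hp hu1 ⟨u, fun hi => hupos _ hi, rfl⟩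
  have hle := Finset.single_le_sum
    (f := fun l : (u.sum + 1).Partition => onParts p l.parts * (dropCount l.parts u : ℝ))
    (fun l _ => mul_nonneg (onParts_nonneg hp _) (Nat.cast_nonneg _))
    (Finset.mem_univ ⟨y ::ₘ t, fun hi => hpos _ hi, hsum⟩)
  have hN : 0 < dropCount (y ::ₘ t) u := by
    rw [dropCount_cons, if_pos rfl]; omega
  have hlt : 0 < onParts p (y ::ₘ t) * (dropCount (y ::ₘ t) u : ℝ) :=
    mul_pos h (Nat.cast_pos.2 hN)
  have : 0 < ((u.sum : ℝ) + 1) * onParts p u := by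
    simp only at hc hle
    rw [hc]; exact hlt.trans_le hle
  exact pos_of_mul_pos_right this (by positivity)

theorem onParts_pos_cons_of_le {p : PartFun} (hp : IsPartitionStructure p) {t : Multiset ℕ}
    {a b : ℕ} (ha : 0 < a) (hab : a ≤ b) (h : 0 < onParts p (b ::ₘ t)) :
    0 < onParts p (a ::ₘ t) := by
  induction b, hab using Nat.le_induction with
  | base => exact h
  | succ b hb ih =>
    have hb0 : b ≠ 0 := by omega
    apply ih
    have := onParts_pos_dropBall hp h (by simp [hb0])
    simpa [hb0, add_comm t, Multiset.singleton_add] using this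

theorem onParts_pos_of_cons {p : PartFun} (hp : IsPartitionStructure p) {t : Multiset ℕ}
    {b : ℕ} (h : 0 < onParts p (b ::ₘ t)) : 0 < onParts p t := by
  by_cases ht : t = 0
  · rw [ht, onParts_zero]; exact one_pos
  have hb := parts_pos_of_onParts_pos h b (Multiset.mem_cons_self _ _)
  simpa using onParts_pos_dropBall hp (onParts_pos_cons_of_le hp one_pos hb h) (by simpa using ht)

theorem onParts_pos_of_le {p : PartFun} (hp : IsPartitionStructure p) {s t : Multiset ℕ}
    (hst : s ≤ t) (h : 0 < onParts p t) : 0 < onParts p s := by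
  obtain ⟨r, rfl⟩ := Multiset.le_iff_exists_add.1 hst
  clear hst
  induction r using Multiset.induction_on with
  | empty => simpa using h
  | cons a r ih =>
    rw [Multiset.add_cons] at h
    exact ih (onParts_pos_of_cons hp h)

theorem onParts_pos_of_replicate {p : PartFun} (hp : IsPartitionStructure p) {K : ℕ}
    (s t : Multiset ℕ) (hs : ∀ i ∈ s, 0 < i ∧ i ≤ K)
    (h : 0 < onParts p (Multiset.replicate s.card K + t)) : 0 < onParts p (s + t) := by
  induction s using Multiset.induction_on generalizing t with
  | empty => simpa using h
  | cons a s ih =>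
    have ha := hs a (Multiset.mem_cons_self _ _)
    rw [Multiset.card_cons, Multiset.replicate_succ, Multiset.cons_add] at h
    have h' := onParts_pos_cons_of_le hp ha.1 ha.2 h
    rw [← Multiset.add_cons] at h'
    -- A part already shrunk from `K` to `a` is stored in `t`, which is why the induction
    -- generalizes over `t`.
    have := ih (a ::ₘ t) (fun i hi => hs i (Multiset.mem_cons_of_mem hi)) h'
    rwa [Multiset.add_cons, ← Multiset.cons_add] at this

theorem onParts_pair_pos {p : PartFun} (hp : IsPartitionStructure p) {k : ℕ} (hk : 0 < k)
    {s : Multiset ℕ} (h : 0 < onParts p s) (hs : 2 ≤ (s.filter (fun x => k ≤ x)).card) :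
    0 < onParts p {k, k} := by
  obtain ⟨a, b, ht⟩ : ∃ a b, ({a, b} : Multiset ℕ) ≤ s.filter (fun x => k ≤ x) := by
    obtain ⟨a, ha⟩ := Multiset.card_pos_iff_exists_mem.1 (zero_lt_two.trans_le hs)
    obtain ⟨t, ht⟩ := Multiset.exists_cons_of_mem ha
    rw [ht, Multiset.card_cons] at hs
    obtain ⟨b, hb⟩ := Multiset.card_pos_iff_exists_mem.1 (show 0 < t.card by omega)
    refine ⟨a, b, ?_⟩
    rw [ht, Multiset.insert_eq_cons]
    exact (Multiset.cons_le_cons_iff a).2 (Multiset.singleton_le.2 hb)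
  have h1 : 0 < onParts p (a ::ₘ {b}) :=
    onParts_pos_of_le hp (ht.trans (Multiset.filter_le _ _)) h
  have hka : k ≤ a := (Multiset.mem_filter.1 (Multiset.mem_of_le ht (by simp))).2
  have hkb : k ≤ b := (Multiset.mem_filter.1 (Multiset.mem_of_le ht (by simp))).2
  have h2 := onParts_pos_cons_of_le hp hk hka h1
  rw [← Multiset.insert_eq_cons, Multiset.pair_comm] at h2
  exact onParts_pos_cons_of_le hp hk hkb h2

/-! ### Hooks and the value at (2, 2) -/

theorem isHookStructure_iff {p : PartFun} (hp : IsPartitionStructure p) :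
    IsHookStructure p ↔ p 4 twoTwo = 0 := by
  classical
  have h22 : p 4 twoTwo = onParts p {2, 2} := (onParts_parts p (by norm_num) twoTwo).symm
  constructor
  · intro h
    have h1 := h 4 (by norm_num)
    have h2 := hp.sum_one 4 (by norm_num)
    rw [← Finset.sum_filter_add_sum_filter_not Finset.univ (fun l => IsHook l)] at h2
    have h3 : ∑ l : Nat.Partition 4 with ¬ IsHook l, p 4 l = 0 := by
      have : ∑ l : Nat.Partition 4 with IsHook l, p 4 l = 1 := by convert h1
      linarith
    refine (Finset.sum_eq_zero_iff_of_nonneg fun l _ => hp.nonneg 4 (by norm_num) l).1 h3 twoTwo ?_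
    have hnot : ¬ IsHook twoTwo := by
      have : Multiset.filter (fun x => 1 < x) ({2, 2} : Multiset ℕ) = {2, 2} := by decide
      unfold IsHook twoTwo
      rw [this]; decide
    simp [hnot]
  · intro h n hn
    rw [← hp.sum_one n hn]
    refine Finset.sum_subset (Finset.subset_univ _) fun l _ hl => ?_
    by_contra hne
    have hl0 : 0 < onParts p l.parts := by
      rw [onParts_parts p hn]; exact lt_of_le_of_ne (hp.nonneg n hn l) (Ne.symm hne)
    have hc : 2 ≤ (l.parts.filter (fun x => 2 ≤ x)).card := by
      by_contra hlt
      exact hl (Finset.mem_filter.2 ⟨Finset.mem_univ _, Nat.lt_succ_iff.1 (not_le.1 hlt)⟩)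
    have := onParts_pair_pos hp two_pos hl0 hc
    rw [← h22, h] at this
    exact lt_irrefl _ this

/-! ### Counting samples: all pairs (k, k) are charged -/

/-- A sample of four balls that induces `(2, 2)` has two balls in one small box if all boxes but one
are small. -/
theorem sampleCount_twoTwo_le {n k : ℕ} (l : n.Partition)
    (hl : (l.parts.filter (fun x => k ≤ x)).card ≤ 1) :
    sampleCount l twoTwo ≤ k * n ^ 3 := by
  classical
  -- Ordered pairs of balls in a common small box: `n` choices for the first, at most `k` for the
  -- second. Equal balls are allowed, since only an upper bound is needed.
  let A : Finset (Balls l × Balls l) :=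
    Finset.univ.filter (fun q => q.1.1 = q.2.1 ∧ q.1.1.1 < k)
  have hA : A.card ≤ n * k := by
    have h := Finset.card_le_mul_card_image_of_maps_to (s := A) (t := Finset.univ)
      (f := Prod.fst) (fun _ _ => Finset.mem_univ _) k ?_
    · rwa [Finset.card_univ, card_balls, mul_comm] at h
    · intro a _
      by_cases hak : a.1.1 < k
      · calc _ ≤ ((Finset.univ : Finset (Fin a.1.1)).image
              (fun i => ((a, ⟨a.1, i⟩) : Balls l × Balls l))).card := by
              refine Finset.card_le_card ?_
              rintro ⟨a', ⟨b, i⟩⟩ hq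
              simp only [A, Finset.mem_filter, Finset.mem_univ, true_and] at hq
              obtain ⟨⟨h1, -⟩, rfl⟩ := hq
              subst h1
              exact Finset.mem_image_of_mem _ (Finset.mem_univ i)
          _ ≤ a.1.1 := Finset.card_image_le.trans (by rw [Finset.card_univ, Fintype.card_fin])
          _ ≤ k := hak.le
      · rw [Finset.card_eq_zero.2]
        · exact Nat.zero_le _
        · refine Finset.filter_eq_empty_iff.2 ?_
          rintro ⟨a', b⟩ hq rfl
          exact hak (Finset.mem_filter.1 hq).2.2
  let B : Finset ((Balls l × Balls l) × (Balls l × Balls l)) := A ×ˢ Finset.univ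
  have hB : B.card ≤ k * n ^ 3 := by
    rw [Finset.card_product, Finset.card_univ, Fintype.card_prod, card_balls]
    calc _ ≤ n * k * (n * n) := Nat.mul_le_mul_right _ hA
      _ = _ := by ring
  -- Each sample is the image of a pair from `A` followed by its two other balls.
  refine le_trans (Finset.card_le_card ?_)
    ((Finset.card_image_le (s := B) (f := fun q => {q.1.1, q.1.2, q.2.1, q.2.2})).trans hB)
  intro S hS
  simp only [Finset.mem_filter, Finset.mem_powersetCard, Finset.subset_univ, true_and] at hS
  obtain ⟨hS4, hS⟩ := hS
  let c : l.parts.ToType → ℕ := fun b => (S.filter (fun a => a.1 = b)).card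
  have hc : ∃ b b' : l.parts.ToType, b ≠ b' ∧ c b = 2 ∧ c b' = 2 := by
    have h2 : 2 = ((Finset.univ : Finset l.parts.ToType).filter (fun b => c b = 2)).card := by
      have h3 := congrArg (Multiset.count 2) hS
      unfold sampleParts at h3
      rw [Multiset.count_filter_of_pos (by norm_num), Multiset.count_map] at h3
      have h4 : Multiset.count 2 twoTwo.parts = 2 := by simp [twoTwo]
      rw [h4] at h3
      rw [Finset.card_def, Finset.filter_val]
      refine h3.symm.trans (congrArg Multiset.card ?_)
      exact Multiset.filter_congr fun b _ => eq_comm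
    obtain ⟨b, b', hne, hbb⟩ := Finset.card_eq_two.1 h2.symm
    have hb : b ∈ (Finset.univ.filter (fun b => c b = 2)) := by rw [hbb]; simp
    have hb' : b' ∈ (Finset.univ.filter (fun b => c b = 2)) := by rw [hbb]; simp
    exact ⟨b, b', hne, (Finset.mem_filter.1 hb).2, (Finset.mem_filter.1 hb').2⟩
  have hsmall : ∃ b : l.parts.ToType, b.1 < k ∧ c b = 2 := by
    obtain ⟨b, b', hne, hb, hb'⟩ := hc
    by_contra! hcon
    have h1 : k ≤ b.1 := by by_contra hlt; exact hcon b (not_le.1 hlt) hb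
    have h2 : k ≤ b'.1 := by by_contra hlt; exact hcon b' (not_le.1 hlt) hb'
    have h3 : (l.parts.filter (fun x => k ≤ x)).card =
        ((Finset.univ : Finset l.parts.ToType).filter (fun b => k ≤ b.1)).card := by
      have h := congrArg (fun t => (Multiset.filter (fun x => k ≤ x) t).card)
        (map_size_univ l.parts)
      refine h.symm.trans ?_
      rw [Multiset.filter_map, Multiset.card_map]
      rfl
    rw [h3] at hl
    exact hne (Finset.card_le_one.1 hl b (by simp [h1]) b' (by simp [h2]))
  obtain ⟨b, hbk, hb⟩ := hsmall
  obtain ⟨x, y, hxy, hfil⟩ := Finset.card_eq_two.1 hb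
  have hrest : (S \ S.filter (fun a => a.1 = b)).card = 2 := by
    rw [Finset.card_sdiff_of_subset (Finset.filter_subset _ _), hS4]
    change 4 - c b = 2
    rw [hb]
  obtain ⟨z, w, hzw, hzwS⟩ := Finset.card_eq_two.1 hrest
  have hx : x ∈ S.filter (fun a => a.1 = b) := by rw [hfil]; simp
  have hy : y ∈ S.filter (fun a => a.1 = b) := by rw [hfil]; simp
  have hx' := (Finset.mem_filter.1 hx).2
  have hy' := (Finset.mem_filter.1 hy).2
  refine Finset.mem_image.2 ⟨((x, y), (z, w)), ?_, ?_⟩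
  · simp only [B, A, Finset.mem_product, Finset.mem_filter, Finset.mem_univ, true_and, and_true]
    exact ⟨hx'.trans hy'.symm, by rw [hx']; exact hbk⟩
  · have := Finset.union_sdiff_of_subset (Finset.filter_subset (fun a => a.1 = b) S)
    rw [hzwS, hfil] at this
    rw [← this]
    ext
    simp only [Finset.mem_insert, Finset.mem_singleton, Finset.mem_union]
    tauto

theorem onParts_pair_pos_of_twoTwo {p : PartFun} (hp : IsPartitionStructure p) (h22 : 0 < p 4 twoTwo)
    {k : ℕ} (hk : 0 < k) : 0 < onParts p {k, k} := by
  by_contra hkk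
  have hbound : ∀ n : ℕ, 4 ≤ n → p 4 twoTwo * (n.choose 4 : ℝ) ≤ k * n ^ 3 := by
    intro n hn
    have hch : (0 : ℝ) < n.choose 4 := by exact_mod_cast Nat.choose_pos hn
    rw [hp.consistent 4 n (by norm_num) hn twoTwo, Finset.sum_mul]
    calc _ ≤ ∑ l : n.Partition, p n l * ((k : ℝ) * n ^ 3) := by
          refine Finset.sum_le_sum fun l _ => ?_
          rw [mul_assoc, sampleProb, div_mul_cancel₀ _ hch.ne']
          rcases (hp.nonneg n (by omega) l).eq_or_lt with h0 | h0
          · rw [← h0]; simp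
          · refine mul_le_mul_of_nonneg_left ?_ h0.le
            have hl : (l.parts.filter (fun x => k ≤ x)).card ≤ 1 := by
              by_contra hl
              refine hkk (onParts_pair_pos hp hk (s := l.parts) ?_ (by omega))
              rwa [onParts_parts p (by omega)]
            exact_mod_cast sampleCount_twoTwo_le l hl
      _ = _ := by rw [← Finset.sum_mul, hp.sum_one n (by omega), one_mul]
  -- The factor 24 is `4!` and 16 is `2^4`, from bounding `24 * n.choose 4` below by `(n/2)^4`.
  -- Taking `n = N + 6` makes `n - 3 = N + 3` at least `n/2`.
  obtain ⟨N, hN⟩ := exists_nat_gt (24 * 16 * (k : ℝ) / p 4 twoTwo)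
  let n := N + 6
  have h1 := hbound n (by omega)
  have h2 : ((n : ℝ) / 2) ^ 4 ≤ 24 * n.choose 4 := by
    have h3 := Nat.pow_sub_le_descFactorial n 4
    rw [Nat.descFactorial_eq_factorial_mul_choose] at h3
    have h4 : ((n + 1 - 4 : ℕ) : ℝ) ^ 4 ≤ 24 * n.choose 4 := by exact_mod_cast h3
    refine le_trans (pow_le_pow_left₀ (by positivity) ?_ 4) h4
    have : n + 1 - 4 = N + 3 := by omega
    rw [this]
    simp only [n]; push_cast; linarith
  have hn0 : (0 : ℝ) < n := by simp only [n]; positivity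
  have h5 : p 4 twoTwo * (n : ℝ) ≤ 24 * 16 * k := by
    have h6 : p 4 twoTwo * ((n : ℝ) / 2) ^ 4 ≤ 24 * (k * n ^ 3) := by
      calc _ ≤ p 4 twoTwo * (24 * n.choose 4) := mul_le_mul_of_nonneg_left h2 h22.le
        _ = 24 * (p 4 twoTwo * n.choose 4) := by ring
        _ ≤ _ := by linarith
    refine le_of_mul_le_mul_right ?_ (pow_pos hn0 3)
    calc _ = 16 * (p 4 twoTwo * ((n : ℝ) / 2) ^ 4) := by ring
      _ ≤ 16 * (24 * (k * n ^ 3)) := by linarith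
      _ = _ := by ring
  rw [div_lt_iff₀ h22] at hN
  have : (n : ℝ) = N + 6 := by simp [n]
  rw [this] at h5
  nlinarith

/-! ### Regeneration and positivity of p -/

theorem toFinset_replicate_of_ne_zero {r : ℕ} (hr : r ≠ 0) (x : ℕ) :
    (Multiset.replicate r x).toFinset = {x} := by
  ext a
  rw [Multiset.mem_toFinset, Multiset.mem_replicate, Finset.mem_singleton]
  exact and_iff_right hr

theorem deletedPartProb_nonneg {p : PartFun} {d : Kernel} (hp : IsPartitionStructure p)
    (hd : IsDeletionKernel d) {n : ℕ} (hn : 1 ≤ n) (x : ℕ) : 0 ≤ deletedPartProb p d n x :=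
  Finset.sum_nonneg fun l _ => mul_nonneg (hd.nonneg n hn l x) (hp.nonneg n hn l)

theorem kernel_eq_one {d : Kernel} (hd : IsDeletionKernel d) {n : ℕ} (hn : 1 ≤ n)
    {l : n.Partition} {x : ℕ} (hl : l.parts.toFinset = {x}) : d n l x = 1 := by
  rw [← hd.sum_one n hn l, hl, Finset.sum_singleton]

theorem parts_eq_singleton {n : ℕ} {l : n.Partition} (h : n ∈ l.parts) : l.parts = {n} := by
  have h1 := Multiset.sum_erase h
  rw [l.parts_sum] at h1
  have h2 : l.parts.erase n = 0 := by
    rw [Multiset.eq_zero_iff_forall_notMem]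
    intro a ha
    have h3 := Multiset.le_sum_of_mem ha
    have h4 := l.parts_pos (Multiset.mem_of_mem_erase ha)
    omega
  rw [← Multiset.cons_erase h, h2]; rfl

/-- The convention that the empty partition has probability 1 extends regeneration to `x = n`, where
the partition is `{n}` and its only part is deleted with certainty. -/
theorem regenerative_onParts {p : PartFun} {d : Kernel} (hd : IsDeletionKernel d)
    (hreg : IsRegenerativeWrt p d) {n : ℕ} (hn : 1 ≤ n) (l : n.Partition) {x : ℕ}
    (hx : x ∈ l.parts) :
    onParts p l.parts * d n l x = deletedPartProb p d n x * onParts p (l.parts.erase x) := by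
  rw [onParts_parts p hn]
  have hxn : x ≤ n := by
    have := Multiset.le_sum_of_mem hx
    rwa [l.parts_sum] at this
  rcases hxn.lt_or_eq with hlt | rfl
  · rw [hreg n hn l x hx hlt, ← onParts_parts p (by omega)]; rfl
  · have hl := parts_eq_singleton hx
    have hd1 : d x l x = 1 := kernel_eq_one hd hn (by rw [hl]; rfl)
    have hq : deletedPartProb p d x x = p x l := by
      unfold deletedPartProb
      rw [Finset.sum_eq_single l, hd1, one_mul]
      · intro l' hl' hne
        exact absurd (Nat.Partition.ext
          ((parts_eq_singleton (Finset.mem_filter.1 hl').2).trans hl.symm)) hne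
      · intro h
        simp [hx] at h
    rw [hq, hd1, hl, Multiset.erase_singleton, onParts_zero]

/-- The kernel has no choice when all parts equal `x`, so `p(x^r) = q(rx,x) p(x^(r-1))`. -/
theorem deletedPartProb_pos_of_replicate {p : PartFun} {d : Kernel} (hp : IsPartitionStructure p)
    (hd : IsDeletionKernel d) (hreg : IsRegenerativeWrt p d) {r x : ℕ} (hr : r ≠ 0)
    (h : 0 < onParts p (Multiset.replicate r x)) : 0 < deletedPartProb p d (r * x) x := by
  have hx : x ∈ Multiset.replicate r x := Multiset.mem_replicate.2 ⟨hr, rfl⟩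
  have hpos := parts_pos_of_onParts_pos h
  have hn : 1 ≤ r * x := Nat.mul_pos (Nat.pos_of_ne_zero hr) (hpos x hx)
  let l : (r * x).Partition := ⟨Multiset.replicate r x, fun hi => hpos _ hi, by simp⟩
  have hd1 : d _ l x = 1 := kernel_eq_one hd hn (toFinset_replicate_of_ne_zero hr x)
  have hrel := regenerative_onParts hd hreg hn l hx
  rw [hd1, mul_one] at hrel
  refine lt_of_le_of_ne (deletedPartProb_nonneg hp hd hn x) fun h0 => ?_
  rw [← h0, zero_mul] at hrel
  exact h.ne' hrel

/-- The hypothesis on the pair makes `q(2m,m)` positive for `m = s.sum`; deleting `m` from `m ::ₘ s`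
leaves `s`, so regeneration transfers positivity upwards. -/
theorem onParts_pos_cons_sum {p : PartFun} {d : Kernel} (hp : IsPartitionStructure p)
    (hd : IsDeletionKernel d) (hreg : IsRegenerativeWrt p d) {s : Multiset ℕ} (hs0 : 0 < s.sum)
    (hpair : 0 < onParts p {s.sum, s.sum}) (hs : 0 < onParts p s) :
    0 < onParts p (s.sum ::ₘ s) := by
  have hq : 0 < deletedPartProb p d (2 * s.sum) s.sum :=
    deletedPartProb_pos_of_replicate hp hd hreg two_ne_zero hpair
  have hpos := parts_pos_of_onParts_pos hs
  let l : (2 * s.sum).Partition :=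
    ⟨s.sum ::ₘ s, fun {i} hi => by
      rcases Multiset.mem_cons.1 hi with rfl | hi
      · exact hs0
      · exact hpos i hi, by simp [two_mul]⟩
  have hrel := regenerative_onParts hd hreg (by omega) l
    (show s.sum ∈ l.parts from Multiset.mem_cons_self _ _)
  have he : l.parts.erase s.sum = s := Multiset.erase_cons_head _ _
  rw [he] at hrel
  refine lt_of_le_of_ne (onParts_nonneg hp _) fun h0 => ?_
  change onParts p (s.sum ::ₘ s) * _ = _ at hrel
  rw [← h0, zero_mul] at hrel
  exact (mul_pos hq hs).ne hrel

theorem onParts_pos {p : PartFun} {d : Kernel} (hp : IsPartitionStructure p)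
    (hd : IsDeletionKernel d) (hreg : IsRegenerativeWrt p d) (h22 : 0 < p 4 twoTwo)
    (s : Multiset ℕ) (hs : ∀ i ∈ s, 0 < i) : 0 < onParts p s := by
  have hrep : ∀ k : ℕ, 0 < k → ∀ r : ℕ, 0 < onParts p (Multiset.replicate r k) := by
    intro k hk r
    induction r with
    | zero => rw [Multiset.replicate_zero, onParts_zero]; exact one_pos
    | succ r ih =>
      -- The doubling argument needs `r * k > 0`, so the single part `k` is obtained from the pair
      -- instead.
      rcases Nat.eq_zero_or_pos r with rfl | hr
      · exact onParts_pos_of_cons hp (b := k) (onParts_pair_pos_of_twoTwo hp h22 hk)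
      · have hsum : (Multiset.replicate r k).sum = r * k := by simp
        have hrk : 0 < r * k := Nat.mul_pos hr hk
        have h := onParts_pos_cons_sum hp hd hreg (s := Multiset.replicate r k)
          (by rw [hsum]; exact hrk) (by rw [hsum]; exact onParts_pair_pos_of_twoTwo hp h22 hrk) ih
        rw [hsum] at h
        rw [Multiset.replicate_succ]
        exact onParts_pos_cons_of_le hp hk (Nat.le_mul_of_pos_left k hr) h
  have h := onParts_pos_of_replicate hp (K := s.sum + 1) s 0
    (fun i hi => ⟨hs i hi, (Multiset.le_sum_of_mem hi).trans (Nat.le_succ _)⟩)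
    (by rw [add_zero]; exact hrep _ (Nat.succ_pos _) _)
  rwa [add_zero] at h

/-! ### A recursion for q and its positivity -/

theorem onParts_eq_sum {p : PartFun} {d : Kernel} (hd : IsDeletionKernel d)
    (hreg : IsRegenerativeWrt p d) {n : ℕ} (hn : 1 ≤ n) (l : n.Partition) :
    onParts p l.parts =
      ∑ x ∈ l.parts.toFinset, deletedPartProb p d n x * onParts p (l.parts.erase x) := by
  rw [← Finset.sum_congr rfl fun x hx =>
    regenerative_onParts hd hreg hn l (Multiset.mem_toFinset.1 hx), ← Finset.mul_sum,
    hd.sum_one n hn l, mul_one]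

theorem sum_partition_erase {m x : ℕ} (hx : 1 ≤ x) (hxm : x ≤ m) (g : Multiset ℕ → ℝ) :
    ∑ l : m.Partition with x ∈ l.parts, g (l.parts.erase x) =
      ∑ l : (m - x).Partition, g l.parts := by
  refine Finset.sum_bij' (fun l hl => removePart l x (Finset.mem_filter.1 hl).2)
    (fun l _ => ⟨x ::ₘ l.parts, fun {i} hi => by
      rcases Multiset.mem_cons.1 hi with rfl | hi
      · exact hx
      · exact l.parts_pos hi, by rw [Multiset.sum_cons, l.parts_sum]; omega⟩) ?_ ?_ ?_ ?_ ?_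
  · intro l _; exact Finset.mem_univ _
  · intro l _; simp
  · intro l hl; exact Nat.Partition.ext (Multiset.cons_erase (Finset.mem_filter.1 hl).2)
  · intro l _; exact Nat.Partition.ext (Multiset.erase_cons_head _ _)
  · intro l _; rfl

theorem sum_onParts_dropCount {p : PartFun} (hp : IsPartitionStructure p) {m : ℕ} (u : Multiset ℕ)
    (hu : ∀ i ∈ u, 0 < i) (hm : m = u.sum + 1) :
    ∑ l : m.Partition, onParts p l.parts * dropCount l.parts u = m * onParts p u := by
  subst hm
  -- Consistency is assumed only from level 1 on; the empty `u` must be checked by hand and occurs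
  -- below when `x` is the only part.
  by_cases h0 : u = 0
  · subst h0
    have h1 := hp.sum_one 1 le_rfl
    have h2 : ∀ l : Nat.Partition 1, l.parts = {1} := fun l => by
      rw [Subsingleton.elim l (Nat.Partition.indiscrete 1)]; rfl
    rw [onParts_zero]
    change ∑ l : Nat.Partition 1, onParts p l.parts * (dropCount l.parts 0 : ℝ) = _
    have h3 : dropCount {1} 0 = 1 := by decide
    rw [Finset.sum_congr rfl fun l _ => by
      rw [onParts_parts p le_rfl, h2, h3, Nat.cast_one, mul_one], h1]
    simp
  · have hn : 1 ≤ u.sum := by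
      obtain ⟨a, ha⟩ := Multiset.exists_mem_of_ne_zero h0
      exact (hu a ha).trans_le (Multiset.le_sum_of_mem ha)
    have h := onParts_consistent hp hn ⟨u, fun hi => hu _ hi, rfl⟩
    simp only at h
    rw [← h]; push_cast; rfl

theorem sum_onParts_add_eq (p : PartFun) {m : ℕ} (u e : Multiset ℕ)
    (hu : ∀ i ∈ u, 0 < i) (hm : m + e.sum = u.sum) :
    ∑ l : m.Partition, onParts p l.parts * (if l.parts + e = u then 1 else 0) =
      if e ≤ u then onParts p (u - e) else 0 := by
  split_ifs with he
  · have hsum : (u - e).sum = m := by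
      have h := congrArg Multiset.sum (Multiset.sub_add_cancel he)
      rw [Multiset.sum_add] at h
      omega
    rw [Finset.sum_eq_single
      ⟨u - e, fun hi => hu _ (Multiset.mem_of_le (Multiset.sub_le_self _ _) hi), hsum⟩]
    · simp [Multiset.sub_add_cancel he]
    · intro l _ hne
      rw [if_neg, mul_zero]
      intro h
      refine hne (Nat.Partition.ext ?_)
      exact (Multiset.add_sub_cancel_right).symm.trans (congrArg (· - e) h)
    · intro h; exact absurd (Finset.mem_univ _) h
  · refine Finset.sum_eq_zero fun l _ => ?_
    rw [if_neg, mul_zero]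
    rintro rfl
    exact he (Multiset.le_add_left _ _)

/-- Delete a part `x` at level `n + 1`, then drop a ball. If the ball is in `x`, the rest is intact
(weight `x`); otherwise consistency applies to the remaining `n + 1 - x` balls, whose number is the
other weight. -/
theorem onParts_eq_sum_succ_aux {p : PartFun} {d : Kernel} (hp : IsPartitionStructure p)
    (hd : IsDeletionKernel d) (hreg : IsRegenerativeWrt p d) {n : ℕ} (hn : 1 ≤ n)
    (u : n.Partition) :
    ((n : ℝ) + 1) * onParts p u.parts =
      ∑ x ∈ Finset.Icc 1 (n + 1), deletedPartProb p d (n + 1) x *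
        (x * (if (if x = 1 then 0 else {x - 1}) ≤ u.parts then
            onParts p (u.parts - if x = 1 then 0 else {x - 1}) else 0) +
          if x ∈ u.parts then ((n : ℝ) + 1 - x) * onParts p (u.parts.erase x) else 0) := by
  have hsub : ∀ l : (n + 1).Partition, l.parts.toFinset ⊆ Finset.Icc 1 (n + 1) := by
    intro l x hx
    rw [Multiset.mem_toFinset] at hx
    have := Multiset.le_sum_of_mem hx
    rw [l.parts_sum] at this
    exact Finset.mem_Icc.2 ⟨l.parts_pos hx, this⟩
  have h1 : ∀ l : (n + 1).Partition, onParts p l.parts * dropCount l.parts u.parts =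
      ∑ x ∈ Finset.Icc 1 (n + 1), if x ∈ l.parts then
        deletedPartProb p d (n + 1) x * (onParts p (l.parts.erase x) *
          dropCount (x ::ₘ l.parts.erase x) u.parts) else 0 := by
    intro l
    rw [onParts_eq_sum hd hreg (by omega) l, Finset.sum_mul, ← Finset.sum_subset (hsub l)]
    · refine Finset.sum_congr rfl fun x hx => ?_
      rw [Multiset.mem_toFinset] at hx
      rw [if_pos hx, Multiset.cons_erase hx, mul_assoc]
    · intro x _ hx
      rw [if_neg (by rwa [Multiset.mem_toFinset] at hx)]
  rw [onParts_consistent hp hn, Finset.sum_congr rfl fun l _ => h1 l, Finset.sum_comm]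
  refine Finset.sum_congr rfl fun x hx => ?_
  obtain ⟨hx1, hxn⟩ := Finset.mem_Icc.1 hx
  rw [← Finset.sum_filter, sum_partition_erase hx1 hxn (fun t => deletedPartProb p d (n + 1) x *
    (onParts p t * dropCount (x ::ₘ t) u.parts)), ← Finset.mul_sum]
  congr 1
  rw [← sum_onParts_add_eq p (m := n + 1 - x) u.parts _ (fun i hi => u.parts_pos hi), Finset.mul_sum]
  · have h2 : (if x ∈ u.parts then ((n : ℝ) + 1 - x) * onParts p (u.parts.erase x) else 0) =
        ∑ l : (n + 1 - x).Partition, onParts p l.parts *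
          (if x ∈ u.parts then (dropCount l.parts (u.parts.erase x) : ℝ) else 0) := by
      split_ifs with hxu
      · have hs := Multiset.sum_erase hxu
        rw [u.parts_sum] at hs
        rw [sum_onParts_dropCount hp _ (fun i hi => u.parts_pos (Multiset.mem_of_mem_erase hi))
          (by omega), Nat.cast_sub hxn]
        push_cast; rfl
      · simp
    rw [h2, ← Finset.sum_add_distrib]
    refine Finset.sum_congr rfl fun l _ => ?_
    rw [dropCount_cons]
    push_cast
    split_ifs <;> ring
  · rw [u.parts_sum]
    split_ifs with h
    · simp; omega
    · simp; omega

theorem onParts_eq_sum_succ {p : PartFun} {d : Kernel} (hp : IsPartitionStructure p)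
    (hd : IsDeletionKernel d) (hreg : IsRegenerativeWrt p d) {n : ℕ} (hn : 1 ≤ n)
    (u : n.Partition) :
    ((n : ℝ) + 1) * onParts p u.parts = deletedPartProb p d (n + 1) 1 * onParts p u.parts +
      ∑ x ∈ u.parts.toFinset, (((x : ℝ) + 1) * deletedPartProb p d (n + 1) (x + 1) +
        ((n : ℝ) + 1 - x) * deletedPartProb p d (n + 1) x) * onParts p (u.parts.erase x) := by
  have hsub : u.parts.toFinset ⊆ Finset.Icc 1 n := by
    intro x hx
    rw [Multiset.mem_toFinset] at hx
    have := Multiset.le_sum_of_mem hx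
    rw [u.parts_sum] at this
    exact Finset.mem_Icc.2 ⟨u.parts_pos hx, this⟩
  have hsub' : u.parts.toFinset ⊆ Finset.Icc 1 (n + 1) :=
    hsub.trans (Finset.Icc_subset_Icc_right (Nat.le_succ n))
  rw [onParts_eq_sum_succ_aux hp hd hreg hn u]
  simp only [mul_add, add_mul]
  rw [Finset.sum_add_distrib, Finset.sum_add_distrib, ← add_assoc]
  congr 1
  · rw [← Finset.add_sum_Ioc_eq_sum_Icc (by omega : 1 ≤ n + 1)]
    congr 1
    · simp
    -- A deleted part `x + 1` that loses a ball appears in `u` as `x`; the sum is reindexed by this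
    -- surviving part.
    · have himg : Finset.Ioc 1 (n + 1) = (Finset.Icc 1 n).map (addRightEmbedding 1) := by
        rw [Finset.map_add_right_Icc]; rfl
      rw [himg, Finset.sum_map]
      refine (Finset.sum_subset_zero_on_sdiff hsub ?_ ?_).symm
      · intro x hx
        rw [Finset.mem_sdiff, Finset.mem_Icc, Multiset.mem_toFinset] at hx
        have : x ≠ 0 := by omega
        simp [this, hx.2]
      · intro x hx
        have hx1 := (Finset.mem_Icc.1 (hsub hx)).1
        have : x ≠ 0 := by omega
        rw [Multiset.mem_toFinset] at hx
        simp [this, hx]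
        ring
  · refine (Finset.sum_subset_zero_on_sdiff hsub' ?_ ?_).symm
    · intro x hx
      rw [Finset.mem_sdiff, Multiset.mem_toFinset] at hx
      rw [if_neg hx.2, mul_zero]
    · intro x hx
      rw [if_pos (Multiset.mem_toFinset.1 hx)]
      ring

theorem deletedPartProb_succ_eq_zero {p : PartFun} {d : Kernel} (hp : IsPartitionStructure p)
    (hd : IsDeletionKernel d) (hreg : IsRegenerativeWrt p d) (h22 : 0 < p 4 twoTwo) {n x : ℕ}
    (hx : 2 ≤ x) (hxn : x < n) (h0 : deletedPartProb p d n x = 0) :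
    deletedPartProb p d (n + 1) x = 0 := by
  have hn : 1 ≤ n := by omega
  -- Both levels expand `p(u)` in the same quantities `p(u - {y})`; `R` is the difference of
  -- coefficients. The partition `1^n` isolates `R 1`, then `(x, 1^(n-x))` isolates `R x`, since `p
  -- > 0`.
  let R : ℕ → ℝ := fun x => (((x : ℝ) + 1) * deletedPartProb p d (n + 1) (x + 1) +
    ((n : ℝ) + 1 - x) * deletedPartProb p d (n + 1) x) -
      ((n : ℝ) + 1 - deletedPartProb p d (n + 1) 1) * deletedPartProb p d n x
  have hR : ∀ u : n.Partition, ∑ y ∈ u.parts.toFinset, R y * onParts p (u.parts.erase y) = 0 := by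
    intro u
    have h1 := onParts_eq_sum_succ hp hd hreg hn u
    have h2 := onParts_eq_sum hd hreg hn u
    simp only [R, sub_mul _ (_ * _), Finset.sum_sub_distrib, mul_assoc ((n : ℝ) + 1 - _)]
    rw [← Finset.mul_sum, ← h2]
    linarith
  have hone : ∀ r : ℕ, ∀ i ∈ Multiset.replicate r 1, 0 < i := fun r i hi => by
    rw [Multiset.eq_of_mem_replicate hi]; exact one_pos
  have hR1 : R 1 = 0 := by
    have h := hR ⟨Multiset.replicate n 1, fun hi => hone n _ hi, by simp⟩
    simp only [toFinset_replicate_of_ne_zero (show n ≠ 0 by omega),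
      Finset.sum_singleton] at h
    exact (mul_eq_zero.1 h).resolve_right (onParts_pos hp hd hreg h22 _ fun i hi =>
      hone n i (Multiset.mem_of_mem_erase hi)).ne'
  have hRx : R x = 0 := by
    have h := hR ⟨x ::ₘ Multiset.replicate (n - x) 1, fun {i} hi => by
      rcases Multiset.mem_cons.1 hi with rfl | hi
      · omega
      · exact hone _ _ hi, by simp; omega⟩
    simp only [Multiset.toFinset_cons,
      toFinset_replicate_of_ne_zero (show n - x ≠ 0 by omega)] at h
    rw [Finset.sum_insert (by simp; omega), Finset.sum_singleton, hR1, zero_mul, add_zero,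
      Multiset.erase_cons_head] at h
    exact (mul_eq_zero.1 h).resolve_right (onParts_pos hp hd hreg h22 _ (hone _)).ne'
  simp only [R, h0, mul_zero, sub_zero] at hRx
  have ha := deletedPartProb_nonneg hp hd (show 1 ≤ n + 1 by omega) (x + 1)
  have hb := deletedPartProb_nonneg hp hd (show 1 ≤ n + 1 by omega) x
  have hc : (0 : ℝ) < (n : ℝ) + 1 - x := by
    have : (x : ℝ) < n := by exact_mod_cast hxn
    linarith
  have h3 : 0 ≤ ((x : ℝ) + 1) * deletedPartProb p d (n + 1) (x + 1) := by positivity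
  have h4 := mul_nonneg hc.le hb
  have h5 : ((n : ℝ) + 1 - x) * deletedPartProb p d (n + 1) x = 0 := by linarith
  exact (mul_eq_zero.1 h5).resolve_left hc.ne'

theorem deletedPartProb_pos {p : PartFun} {d : Kernel} (hp : IsPartitionStructure p)
    (hd : IsDeletionKernel d) (hreg : IsRegenerativeWrt p d) (h22 : 0 < p 4 twoTwo) {n x : ℕ}
    (hx : 1 ≤ x) (hxn : x ≤ n) : 0 < deletedPartProb p d n x := by
  have hmul : ∀ r : ℕ, r ≠ 0 → 0 < deletedPartProb p d (r * x) x := fun r hr =>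
    deletedPartProb_pos_of_replicate hp hd hreg hr (onParts_pos hp hd hreg h22 _ fun i hi => by
      rw [Multiset.eq_of_mem_replicate hi]; exact hx)
  by_cases hx1 : x = 1
  · subst hx1
    simpa using hmul n (by omega)
  rcases hxn.eq_or_lt with rfl | hlt
  · simpa using hmul 1 one_ne_zero
  refine lt_of_le_of_ne (deletedPartProb_nonneg hp hd (by omega) x) fun h0 => ?_
  have hall : ∀ m, n ≤ m → deletedPartProb p d m x = 0 := by
    intro m hm
    induction m, hm using Nat.le_induction with
    | base => exact h0.symm
    | succ m hm ih =>
      exact deletedPartProb_succ_eq_zero hp hd hreg h22 (by omega) (by omega) ih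
  -- The persisting zero reaches the multiple `n * x ≥ n` of `x`, where `q` is positive.
  exact (hmul n (by omega)).ne' (hall _ (Nat.le_mul_of_pos_right n hx))

theorem allPositive_iff {p : PartFun} {d : Kernel} (hp : IsPartitionStructure p)
    (hd : IsDeletionKernel d) (hreg : IsRegenerativeWrt p d) :
    AllPositive p d ↔ 0 < p 4 twoTwo := by
  refine ⟨fun h => h.p_pos 4 (by norm_num) twoTwo, fun h22 => ?_⟩
  have hpos := onParts_pos hp hd hreg h22
  refine ⟨fun n hn l => ?_, fun n hn l x hx => ?_, fun n _ x hx hxn =>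
    deletedPartProb_pos hp hd hreg h22 hx hxn⟩
  · rw [← onParts_parts p hn]
    exact hpos _ fun i hi => l.parts_pos hi
  · have hxn : x ≤ n := by
      have := Multiset.le_sum_of_mem hx
      rwa [l.parts_sum] at this
    have h : 0 < onParts p l.parts * d n l x := by
      rw [regenerative_onParts hd hreg hn l hx]
      exact mul_pos (deletedPartProb_pos hp hd hreg h22 (l.parts_pos hx) hxn)
        (hpos _ fun i hi => l.parts_pos (Multiset.mem_of_mem_erase hi))
    exact pos_of_mul_pos_right h (onParts_nonneg hp _)

end RegenPartition

theorem mainTheorem9 (p : RegenPartition.PartFun) (d : RegenPartition.Kernel)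
    (hp : RegenPartition.IsPartitionStructure p)
    (hd : RegenPartition.IsDeletionKernel d)
    (hreg : RegenPartition.IsRegenerativeWrt p d) :
    (RegenPartition.IsHookStructure p ∨ RegenPartition.AllPositive p d) ∧
    (RegenPartition.IsHookStructure p ↔ p 4 RegenPartition.twoTwo = 0) ∧
    (RegenPartition.AllPositive p d ↔ 0 < p 4 RegenPartition.twoTwo) := by
  have h1 := RegenPartition.isHookStructure_iff hp
  have h2 := RegenPartition.allPositive_iff hp hd hreg
  refine ⟨?_, h1, h2⟩
  rw [h1, h2]
  exact (hp.nonneg 4 (by norm_num) _).eq_or_lt.imp Eq.symm id
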